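/- All graphs are finite and simple, and the graph with no vertices is allowed. Write $\overline{G}$ for the complement of $G$, $K_n$ for the complete graph on $n$ vertices ($n \ge 0$), $\sqcup$ for disjoint union and $\boxtimes$ for the strong graph product. Let $\mathcal{G}=(\mathcal{G},\sqcup,\boxtimes,K_0,K_1)$ be the commutative semiring of isomorphism classes of graphs. There is a quantum homomorphism $G\overset{q}{\to}H$ if there are an integer $d\ge 1$ and Hermitian idempotents $E_g^h\in M(d,\mathbb{C})$ for $g\in V(G)$, $h\in V(H)$, such that $\sum_{h\in V(H)}E_g^h=I_d$ for every $g\in V(G)$, and $E_g^hE_{g'}^{h'}=0$ whenever $\{g,g'\}\in E(G)$ and $\{h,h'\}\notin E(H)$ (including the case $h=h'$). The quantum cohomomorphism preorder is defined by $G\le_q H$ if and only if $\overline{G}\overset{q}{\to}\overline{H}$. The quantum independence number is $\alpha_q(G)=\max\{n\in\mathbb{N}:\overline{K_n}\le_q G\}$. The quantum Shannon capacity is \[ \Theta_q(G)=\lim_{N\to\infty}\sqrt[N]{\alpha_q(G^{\boxtimes N})}=\sup_{N\ge 1}\sqrt[N]{\alpha_q(G^{\boxtimes N})}. \] The asymptotic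 spectrum $\mathbf{X}(\mathcal{G},\le_q)$ is the set of semiring homomorphisms $\phi:\mathcal{G}\to\mathbb{R}_{\ge 0}$ such that $\phi(G)\le\phi(H)$ for all graphs $G,H$ with $G\le_q H$. **Theorem.** Let $G$ be a graph. Then the maximum defining $\alpha_q(G)$ exists, the limit defining $\Theta_q(G)$ exists and equals the above supremum, and \[ \Theta_q(G)=\min_{\phi\in\mathbf{X}(\mathcal{G},\le_q)}\phi(G), \] where the minimum is attained. -/

import Mathlib

open Filter Topology
open scoped NNReal

/-- The strong product `G ⊠ H`: distinct pairs `(g, h)`, `(g', h')` are adjacent when in each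
coordinate the entries are equal or adjacent (written out as the usual three cases). -/
def strongProd {V W : Type*} (G : SimpleGraph V) (H : SimpleGraph W) : SimpleGraph (V × W) where
  Adj x y := (x.1 = y.1 ∧ H.Adj x.2 y.2) ∨ (G.Adj x.1 y.1 ∧ H.Adj x.2 y.2) ∨
    (G.Adj x.1 y.1 ∧ x.2 = y.2)
  symm := ⟨by
    rintro x y (⟨h, k⟩ | ⟨h, k⟩ | ⟨h, k⟩)
    · exact Or.inl ⟨h.symm, k.symm⟩
    · exact Or.inr (Or.inl ⟨h.symm, k.symm⟩)
    · exact Or.inr (Or.inr ⟨h.symm, k.symm⟩)⟩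
  loopless := ⟨by
    rintro x (⟨_, k⟩ | ⟨h, _⟩ | ⟨h, _⟩)
    · exact H.loopless.irrefl _ k
    · exact G.loopless.irrefl _ h
    · exact G.loopless.irrefl _ h⟩

/-- There is a quantum homomorphism from `G` to `H`: complex `d × d` projectors `E g h`
(Hermitian idempotents, `d ≥ 1`) that sum to the identity over `h` for each `g`, with
`E g h * E g' h' = 0` whenever `g, g'` are adjacent and `h, h'` are not (`h = h'` included). -/
def QuantumHom {V W : Type*} [Fintype W] (G : SimpleGraph V) (H : SimpleGraph W) : Prop :=
  ∃ d : ℕ, 0 < d ∧ ∃ E : V → W → Matrix (Fin d) (Fin d) ℂ,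
    (∀ g h, IsStarProjection (E g h)) ∧
    (∀ g, ∑ h, E g h = 1) ∧
    (∀ g g' h h', G.Adj g g' → ¬ H.Adj h h' → E g h * E g' h' = 0)

/-- The quantum cohomomorphism preorder `G ≤_q H`: a quantum homomorphism between complements. -/
def QuantumCohom {V W : Type*} [Fintype W] (G : SimpleGraph V) (H : SimpleGraph W) : Prop :=
  QuantumHom Gᶜ Hᶜ

theorem QuantumCohom.congr {V V' W W' : Type*} [Fintype W] [Fintype W']
    {G : SimpleGraph V} {G' : SimpleGraph V'} {H : SimpleGraph W} {H' : SimpleGraph W'}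
    (e : G ≃g G') (f : H ≃g H') (h : QuantumCohom G H) : QuantumCohom G' H' := by
  obtain ⟨d, hd, E, h1, h2, h3⟩ := h
  refine ⟨d, hd, fun g k => E (e.symm g) (f.symm k), fun _ _ => h1 _ _, fun g => ?_, ?_⟩
  · rw [← h2 (e.symm g)]
    exact f.symm.toEquiv.sum_comp (fun k => E (e.symm g) k)
  · intro g g' k k' hg hk
    refine h3 _ _ _ _ ?_ ?_
    · simpa [SimpleGraph.compl_adj, SimpleGraph.Iso.map_adj_iff] using hg
    · simpa [SimpleGraph.compl_adj, SimpleGraph.Iso.map_adj_iff] using hk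

universe u

/-- A finite simple graph. -/
structure FinGraph : Type (u + 1) where
  vertex : Type u
  [fin : Fintype vertex]
  graph : SimpleGraph vertex

attribute [instance] FinGraph.fin

instance FinGraph.isoSetoid : Setoid FinGraph.{u} where
  r G H := Nonempty (G.graph ≃g H.graph)
  iseqv := ⟨fun _ => ⟨SimpleGraph.Iso.refl⟩, fun ⟨e⟩ => ⟨e.symm⟩, fun ⟨e⟩ ⟨f⟩ => ⟨f.comp e⟩⟩

/-- Isomorphism classes of finite simple graphs. -/
def GraphClass : Type (u + 1) := Quotient FinGraph.isoSetoid.{u}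

namespace GraphClass

/-- The isomorphism class of `G`. -/
def mk {V : Type u} [Fintype V] (G : SimpleGraph V) : GraphClass.{u} :=
  Quotient.mk _ ⟨V, G⟩

theorem mk_eq_of_iso {V W : Type u} [Fintype V] [Fintype W] {G : SimpleGraph V}
    {H : SimpleGraph W} (e : G ≃g H) : mk G = mk H :=
  Quotient.sound ⟨e⟩

/-- The class of the edgeless graph on `n` vertices, the complement of `K_n`. -/
def edgeless (n : ℕ) : GraphClass.{u} := mk (⊥ : SimpleGraph (ULift.{u} (Fin n)))

/-- Disjoint union of graphs. -/
instance : Add GraphClass.{u} where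
  add := Quotient.map₂ (fun G H => ⟨G.vertex ⊕ H.vertex, G.graph ⊕g H.graph⟩)
    (by
      rintro G G' ⟨e⟩ H H' ⟨f⟩
      exact ⟨SimpleGraph.Iso.sumCongr e f⟩)

/-- Strong product of graphs. -/
instance : Mul GraphClass.{u} where
  mul := Quotient.map₂ (fun G H => ⟨G.vertex × H.vertex, strongProd G.graph H.graph⟩)
    (by
      rintro G G' ⟨e⟩ H H' ⟨f⟩
      refine ⟨⟨e.toEquiv.prodCongr f.toEquiv, ?_⟩⟩
      rintro ⟨a, b⟩ ⟨c, d⟩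
      simp [strongProd, SimpleGraph.Iso.map_adj_iff])

instance : Zero GraphClass.{u} := ⟨edgeless 0⟩

instance : One GraphClass.{u} := ⟨edgeless 1⟩

theorem mk_add_mk {V W : Type u} [Fintype V] [Fintype W] (G : SimpleGraph V)
    (H : SimpleGraph W) : mk G + mk H = mk (G ⊕g H) := rfl

theorem mk_mul_mk {V W : Type u} [Fintype V] [Fintype W] (G : SimpleGraph V)
    (H : SimpleGraph W) : mk G * mk H = mk (strongProd G H) := rfl

theorem ind {p : GraphClass.{u} → Prop}
    (h : ∀ (V : Type u) [Fintype V] (G : SimpleGraph V), p (mk G)) (a : GraphClass.{u}) : p a :=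
  Quotient.inductionOn a fun G => h G.vertex G.graph

protected theorem add_comm (a b : GraphClass.{u}) : a + b = b + a := by
  induction a using ind with | _ V G
  induction b using ind with | _ W H
  exact mk_eq_of_iso SimpleGraph.Iso.sumComm

protected theorem mul_comm (a b : GraphClass.{u}) : a * b = b * a := by
  induction a using ind with | _ V G
  induction b using ind with | _ W H
  refine mk_eq_of_iso ⟨Equiv.prodComm _ _, ?_⟩
  rintro ⟨a, b⟩ ⟨c, d⟩
  simp only [strongProd, Equiv.prodComm_apply, Prod.swap]
  tauto

protected theorem zero_add (a : GraphClass.{u}) : edgeless 0 + a = a := by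
  induction a using ind with | _ V G
  refine mk_eq_of_iso ⟨Equiv.emptySum _ _, ?_⟩
  rintro (⟨⟨a⟩⟩ | a) (⟨⟨b⟩⟩ | b)
  all_goals first
    | exact a.elim0
    | exact b.elim0
    | simp [SimpleGraph.sum]

protected theorem zero_mul (a : GraphClass.{u}) : edgeless 0 * a = edgeless 0 := by
  induction a using ind with | _ V G
  refine mk_eq_of_iso ⟨⟨fun x => x.1, fun x => x.down.elim0, ?_, ?_⟩, ?_⟩
  · rintro ⟨⟨a⟩, _⟩
    exact a.elim0
  · rintro ⟨a⟩
    exact a.elim0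
  · rintro ⟨⟨a⟩, _⟩
    exact a.elim0

protected theorem one_mul (a : GraphClass.{u}) : edgeless 1 * a = a := by
  induction a using ind with | _ V G
  refine mk_eq_of_iso ⟨Equiv.uniqueProd _ _, ?_⟩
  rintro ⟨a, b⟩ ⟨c, d⟩
  simp [strongProd, Subsingleton.elim a c]

protected theorem add_mul (a b c : GraphClass.{u}) : (a + b) * c = a * c + b * c := by
  induction a using ind with | _ V G
  induction b using ind with | _ W H
  induction c using ind with | _ U K
  refine mk_eq_of_iso ⟨Equiv.sumProdDistrib _ _ _, ?_⟩
  rintro ⟨a | a, b⟩ ⟨c | c, d⟩ <;> simp [strongProd, SimpleGraph.sum]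

/-- The semiring `(𝒢, ⊔, ⊠, K_0, K_1)` of isomorphism classes of finite simple graphs. -/
instance : CommSemiring GraphClass.{u} where
  natCast := edgeless
  natCast_zero := rfl
  natCast_succ n := by
    refine mk_eq_of_iso ⟨(Equiv.ulift.trans (finSumFinEquiv.symm.trans
      (Equiv.sumCongr Equiv.ulift.symm Equiv.ulift.symm))), ?_⟩
    intro a b
    generalize (Equiv.ulift.trans (finSumFinEquiv.symm.trans
      (Equiv.sumCongr Equiv.ulift.symm Equiv.ulift.symm))) a = x
    generalize (Equiv.ulift.trans (finSumFinEquiv.symm.trans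
      (Equiv.sumCongr Equiv.ulift.symm Equiv.ulift.symm))) b = y
    rcases x with x | x <;> rcases y with y | y <;> simp [SimpleGraph.sum]
  add_assoc a b c := by
    induction a using ind with | _ V G
    induction b using ind with | _ W H
    induction c using ind with | _ U K
    exact mk_eq_of_iso SimpleGraph.Iso.sumAssoc
  zero_add := GraphClass.zero_add
  add_zero a := (GraphClass.add_comm _ _).trans (GraphClass.zero_add a)
  add_comm := GraphClass.add_comm
  nsmul := nsmulRec
  npow := npowRec
  left_distrib a b c := by
    rw [GraphClass.mul_comm, GraphClass.add_mul, GraphClass.mul_comm b, GraphClass.mul_comm c]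
  right_distrib := GraphClass.add_mul
  zero_mul := GraphClass.zero_mul
  mul_zero a := (GraphClass.mul_comm _ _).trans (GraphClass.zero_mul a)
  mul_assoc a b c := by
    induction a using ind with | _ V G
    induction b using ind with | _ W H
    induction c using ind with | _ U K
    refine mk_eq_of_iso ⟨Equiv.prodAssoc _ _ _, ?_⟩
    rintro ⟨⟨a, b⟩, c⟩ ⟨⟨a', b'⟩, c'⟩
    simp only [strongProd, Equiv.prodAssoc_apply, Prod.mk.injEq]
    tauto
  one_mul := GraphClass.one_mul
  mul_one a := (GraphClass.mul_comm _ _).trans (GraphClass.one_mul a)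
  mul_comm := GraphClass.mul_comm

/-- The quantum cohomomorphism preorder on isomorphism classes. -/
def QLE : GraphClass.{u} → GraphClass.{u} → Prop :=
  Quotient.lift₂ (fun G H => QuantumCohom G.graph H.graph) (by
    rintro G H G' H' ⟨e⟩ ⟨f⟩
    exact propext ⟨QuantumCohom.congr e f, QuantumCohom.congr e.symm f.symm⟩)

/-- The quantum independence number: the largest `n` with (complement of `K_n`) `≤_q a`. -/
noncomputable def quantumIndepNum (a : GraphClass.{u}) : ℕ :=
  sSup {n : ℕ | QLE (edgeless n) a}

/-- The `N`-th root of the quantum independence number of the `N`-th strong power. -/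
noncomputable def quantumIndepRoot (a : GraphClass.{u}) (N : ℕ) : ℝ :=
  (quantumIndepNum (a ^ N) : ℝ) ^ (1 / (N : ℝ))

/-- The quantum Shannon capacity, the limit of `quantumIndepRoot a N` as `N → ∞`. -/
noncomputable def quantumShannonCapacity (a : GraphClass.{u}) : ℝ :=
  limUnder atTop (quantumIndepRoot a)

/-- The asymptotic spectrum of graphs with respect to the quantum cohomomorphism preorder:
the monotone semiring homomorphisms to the nonnegative reals. -/
def quantumAsymptoticSpectrum : Set (GraphClass.{u} →+* ℝ≥0) :=
  {φ | ∀ a b : GraphClass.{u}, QLE a b → φ a ≤ φ b}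

end GraphClass

/-! This is Strassen's spectral duality applied to `≤_q`. Write `θ` for the limit. Fekete's lemma
gives the limit and the supremum, and `θ ≤ φ(G)` because a monotone semiring homomorphism sends the
edgeless graph on `n` vertices to `n`.

For the reverse inequality, Zorn's lemma extends any nondegenerate Archimedean preorder to a total
one (`exists_total`). A total one measures every element against the naturals, and this measurement
`rank` is a monotone homomorphism. Monotone homomorphisms form a compact set, so some `φ` minimizes
the value at `a = [G]`.

Suppose `2 ≤ a` and `r > θ^M`. If imposing `a^M ≤ r` were degenerate, `exists_pow_le_mul_pow` would
give `r^N ≤ R a^(MN) ≤ a^(R+MN)` for all `N`, hence `r^N ≤ θ^R θ^(MN)`, which fails for large `N`.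
So `a^M ≤ r` can be imposed, and a homomorphism monotone for the extension shows `φ(a)^M ≤ ⌊θ^M⌋ + 1
≤ 2 θ^M`. Letting `M` grow gives `φ(a) ≤ θ`. If `a = 0` or `a ≤ 1` the bound is direct. -/

/-! ### Strassen preorders and total extensions -/

/-- A nondegenerate Archimedean preorder on a commutative semiring that is compatible with the
semiring operations. -/
structure IsStrassenPreorder {S : Type*} [CommSemiring S] (P : S → S → Prop) : Prop where
  refl : ∀ a, P a a
  trans : ∀ a b c, P a b → P b c → P a c
  add_right : ∀ a b c, P a b → P (a + c) (b + c)
  mul_right : ∀ a b c, P a b → P (a * c) (b * c)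
  zero_le : ∀ a, P 0 a
  one_le : ∀ a, a ≠ 0 → P 1 a
  exists_le_natCast : ∀ a, ∃ n : ℕ, P a n
  not_succ_le : ∀ n : ℕ, ¬ P (n + 1 : ℕ) n

/-- The preorder obtained from `P` by forcing `a ≤ b`. -/
def extendPreorder {S : Type*} [CommSemiring S] (P : S → S → Prop) (a b : S) (x y : S) : Prop :=
  ∃ s, P (x + s * b) (y + s * a)

namespace IsStrassenPreorder

variable {S : Type*} [CommSemiring S] {P : S → S → Prop}

theorem add_left (h : IsStrassenPreorder P) {a b : S} (c : S) (hab : P a b) :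
    P (c + a) (c + b) := by
  simpa [add_comm] using h.add_right a b c hab

theorem mul_left (h : IsStrassenPreorder P) {a b : S} (c : S) (hab : P a b) :
    P (c * a) (c * b) := by
  simpa [mul_comm] using h.mul_right a b c hab

theorem add_le_add (h : IsStrassenPreorder P) {a b c d : S} (hab : P a b) (hcd : P c d) :
    P (a + c) (b + d) :=
  h.trans _ _ _ (h.add_right _ _ _ hab) (h.add_left _ hcd)

theorem mul_le_mul (h : IsStrassenPreorder P) {a b c d : S} (hab : P a b) (hcd : P c d) :
    P (a * c) (b * d) :=
  h.trans _ _ _ (h.mul_right _ _ _ hab) (h.mul_left _ hcd)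

theorem pow_le_pow (h : IsStrassenPreorder P) {a b : S} (hab : P a b) (n : ℕ) :
    P (a ^ n) (b ^ n) := by
  induction n with
  | zero => simpa using h.refl 1
  | succ n ih => simpa [pow_succ] using h.mul_le_mul ih hab

theorem le_add_left (h : IsStrassenPreorder P) (a b : S) : P a (b + a) := by
  simpa using h.add_right 0 b a (h.zero_le b)

theorem natCast_le (h : IsStrassenPreorder P) {m n : ℕ} : P (m : S) n ↔ m ≤ n := by
  constructor
  · intro hmn
    by_contra! hlt
    obtain ⟨k, rfl⟩ := Nat.exists_eq_add_of_lt hlt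
    refine h.not_succ_le n (h.trans _ _ _ ?_ hmn)
    have := h.le_add_left ((n + 1 : ℕ) : S) (k : S)
    push_cast at this ⊢
    convert this using 1
    ring
  · intro hmn
    obtain ⟨k, rfl⟩ := Nat.exists_eq_add_of_le hmn
    simpa [add_comm] using h.le_add_left (m : S) (k : S)

/-- Every other axiom passes to the extension, so nondegeneracy is the only obstruction to imposing
a new inequality. -/
theorem extend (h : IsStrassenPreorder P) (a b : S)
    (hab : ∀ n : ℕ, ¬ extendPreorder P a b (n + 1 : ℕ) n) :
    IsStrassenPreorder (extendPreorder P a b) := by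
  have hle : ∀ x y, P x y → extendPreorder P a b x y := fun x y hxy => ⟨0, by simpa using hxy⟩
  refine ⟨fun x => hle _ _ (h.refl x), ?_, ?_, ?_, fun x => hle _ _ (h.zero_le x),
    fun x hx => hle _ _ (h.one_le x hx), fun x => (h.exists_le_natCast x).imp fun _ => hle _ _,
    hab⟩
  · rintro x y z ⟨s, hs⟩ ⟨t, ht⟩
    refine ⟨s + t, h.trans _ (y + s * a + t * b) _ ?_ ?_⟩
    · convert h.add_right _ _ (t * b) hs using 1
      ring
    · convert h.add_right _ _ (s * a) ht using 1 <;> ring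
  · rintro x y z ⟨s, hs⟩
    refine ⟨s, ?_⟩
    convert h.add_right _ _ z hs using 1 <;> ring
  · rintro x y z ⟨s, hs⟩
    refine ⟨s * z, ?_⟩
    convert h.mul_right _ _ z hs using 1 <;> ring

theorem le_extendPreorder {a b x y : S} (hxy : P x y) :
    extendPreorder P a b x y :=
  ⟨0, by simpa using hxy⟩

theorem extendPreorder_self (h : IsStrassenPreorder P) (a b : S) : extendPreorder P a b a b :=
  ⟨1, by simpa [add_comm] using h.refl (a + b)⟩

/-- There is no cancellation, but iterating gives `k + w ≤ w` for every `k`, which contradicts an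
Archimedean bound `w ≤ r` at `k = r + 1`. -/
theorem not_one_add_le (h : IsStrassenPreorder P) (w : S) : ¬ P (1 + w) w := by
  intro hw
  have key : ∀ k : ℕ, P ((k : S) + w) w := by
    intro k
    induction k with
    | zero => simpa using h.refl w
    | succ k ih =>
      refine h.trans _ _ _ ?_ hw
      convert h.add_left 1 ih using 1
      push_cast
      ring
  obtain ⟨r, hr⟩ := h.exists_le_natCast w
  have h1 : P ((r + 1 : ℕ) : S) ((r + 1 : ℕ) + w) := by
    simpa [add_comm] using h.le_add_left ((r + 1 : ℕ) : S) w
  exact h.not_succ_le r (h.trans _ _ _ h1 (h.trans _ _ _ (key _) hr))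

/-- One of the two comparisons between `x` and `y` can be added without degeneracy. -/
theorem extend_or (h : IsStrassenPreorder P) (x y : S) :
    IsStrassenPreorder (extendPreorder P x y) ∨ IsStrassenPreorder (extendPreorder P y x) := by
  by_contra! hcon
  have h1 : ∃ n : ℕ, extendPreorder P x y (n + 1 : ℕ) n := by
    by_contra! hc
    exact hcon.1 (h.extend _ _ hc)
  have h2 : ∃ n : ℕ, extendPreorder P y x (n + 1 : ℕ) n := by
    by_contra! hc
    exact hcon.2 (h.extend _ _ hc)
  obtain ⟨n, s, hs⟩ := h1
  obtain ⟨m, t, ht⟩ := h2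
  have hs0 : s ≠ 0 := by
    rintro rfl
    exact h.not_succ_le n (by simpa using hs)
  -- The two degeneracies are weighted by `t` and `s` so that the `x` and `y` terms agree on both
  -- sides; what remains is `t + s + w ≤ w`, with `1 ≤ s`.
  have hsum := h.add_le_add (h.mul_right _ _ t hs) (h.mul_right _ _ s ht)
  set w : S := n * t + m * s + s * t * (x + y) with hw
  refine h.not_one_add_le w (h.trans _ _ _ (h.add_right _ _ w (h.one_le s hs0))
    (h.trans _ (t + (s + w)) _ (h.le_add_left _ _) ?_))
  convert hsum using 1 <;> · rw [hw]; push_cast; ring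

/-- A maximal extension is total, since by `extend_or` one of any two opposite comparisons could be
added to it. Degeneracy is witnessed by a single comparison, so unions of chains stay nondegenerate.
-/
theorem exists_total (h : IsStrassenPreorder P) :
    ∃ Q : S → S → Prop, IsStrassenPreorder Q ∧ (∀ a b, P a b → Q a b) ∧
      ∀ a b, Q a b ∨ Q b a := by
  obtain ⟨Q, hPQ, hQ⟩ := zorn_le_nonempty₀ {Q : S → S → Prop | IsStrassenPreorder Q} (by
    intro c hc hchain Q₀ hQ₀
    refine ⟨fun a b => ∃ Q ∈ c, Q a b, ?_, fun Q hQ a b hab => ⟨Q, hQ, hab⟩⟩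
    have h0 := hc hQ₀
    refine ⟨fun a => ⟨Q₀, hQ₀, h0.refl a⟩, ?_, ?_, ?_, fun a => ⟨Q₀, hQ₀, h0.zero_le a⟩,
      fun a ha => ⟨Q₀, hQ₀, h0.one_le a ha⟩,
      fun a => (h0.exists_le_natCast a).imp fun _ hn => ⟨Q₀, hQ₀, hn⟩, ?_⟩
    · rintro x y z ⟨Q₁, h₁, hxy⟩ ⟨Q₂, h₂, hyz⟩
      rcases hchain.total h₁ h₂ with hle | hle
      · exact ⟨Q₂, h₂, (hc h₂).trans _ _ _ (hle _ _ hxy) hyz⟩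
      · exact ⟨Q₁, h₁, (hc h₁).trans _ _ _ hxy (hle _ _ hyz)⟩
    · rintro x y z ⟨Q₁, h₁, hxy⟩
      exact ⟨Q₁, h₁, (hc h₁).add_right _ _ _ hxy⟩
    · rintro x y z ⟨Q₁, h₁, hxy⟩
      exact ⟨Q₁, h₁, (hc h₁).mul_right _ _ _ hxy⟩
    · rintro n ⟨Q₁, h₁, hn⟩
      exact (hc h₁).not_succ_le n hn) P h
  have hQS : IsStrassenPreorder Q := hQ.prop
  refine ⟨Q, hQS, hPQ, fun a b => ?_⟩
  have key : ∀ x y, IsStrassenPreorder (extendPreorder Q x y) → Q x y := fun x y hxy =>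
    hQ.le_of_ge hxy (fun u v huv => le_extendPreorder huv) _ _ (hQS.extendPreorder_self x y)
  exact (hQS.extend_or a b).imp (key a b) (key b a)

/-! ### The homomorphism of a total preorder -/

/-- The value of `a` measured against the natural numbers. -/
noncomputable def rank (P : S → S → Prop) (a : S) : ℝ :=
  sSup {t : ℝ | ∃ r s : ℕ, 0 < s ∧ P r (s * a) ∧ t = r / s}

theorem natCast_le_rank_and (h : IsStrassenPreorder P) (a : S) :
    (∀ r s : ℕ, P r (s * a) → (r : ℝ) ≤ s * rank P a) ∧
      ∀ r s : ℕ, P (s * a) r → s * rank P a ≤ r := by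
  have cross : ∀ r s r' s' : ℕ, P r (s * a) → P (s' * a) r' → s' * r ≤ s * r' := by
    intro r s r' s' h1 h2
    rw [← h.natCast_le]
    push_cast
    refine h.trans _ _ _ (h.mul_left _ h1) ?_
    convert h.mul_left (s : S) h2 using 1
    ring
  have ub : ∀ r s : ℕ, 0 < s → P (s * a) r →
      (r : ℝ) / s ∈ upperBounds {t : ℝ | ∃ r s : ℕ, 0 < s ∧ P r (s * a) ∧ t = r / s} := by
    rintro r' s' hs' h2 _ ⟨r, s, hs, h1, rfl⟩
    rw [div_le_div_iff₀ (by positivity) (by positivity)]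
    have := cross _ _ _ _ h1 h2
    rw [mul_comm (r : ℝ), mul_comm (r' : ℝ)]
    exact_mod_cast this
  constructor
  · intro r s h1
    rcases Nat.eq_zero_or_pos s with rfl | hs
    · have : P (r : S) (0 : ℕ) := by simpa using h1
      rw [h.natCast_le] at this
      obtain rfl : r = 0 := by omega
      simp
    · obtain ⟨n, hn⟩ := h.exists_le_natCast a
      have : (r : ℝ) / s ≤ rank P a :=
        le_csSup ⟨_, ub n 1 one_pos (by simpa using hn)⟩ ⟨r, s, hs, h1, rfl⟩
      rwa [div_le_iff₀' (by positivity)] at this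
  · intro r s h2
    rcases Nat.eq_zero_or_pos s with rfl | hs
    · simp
    · have : rank P a ≤ (r : ℝ) / s :=
        csSup_le ⟨0, 0, 1, one_pos, by simpa using h.zero_le a, by simp⟩ (ub r s hs h2)
      rwa [le_div_iff₀' (by positivity)] at this

theorem rank_natCast (h : IsStrassenPreorder P) (n : ℕ) : rank P (n : S) = n := by
  have := h.natCast_le_rank_and (n : S)
  have h1 := this.1 n 1 (by simpa using h.refl (n : S))
  have h2 := this.2 n 1 (by simpa using h.refl (n : S))
  push_cast at h1 h2
  linarith

theorem rank_nonneg (h : IsStrassenPreorder P) (a : S) : 0 ≤ rank P a := by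
  have := (h.natCast_le_rank_and a).1 0 1 (by simpa using h.zero_le a)
  simpa using this

/-- An integer part for `a`. Applied to `s * a`, it determines `s * rank P a` up to an error of 1,
and the errors vanish after division by a large `s`. -/
theorem exists_natCast_approx (h : IsStrassenPreorder P) (htot : ∀ a b, P a b ∨ P b a) (a : S) :
    ∃ r : ℕ, P r a ∧ P a (r + 1 : ℕ) := by
  classical
  obtain ⟨n, hn⟩ := h.exists_le_natCast a
  have hex : ∃ n : ℕ, P a (n + 1 : ℕ) := ⟨n, h.trans _ _ _ hn (h.natCast_le.2 (by omega))⟩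
  refine ⟨Nat.find hex, ?_, Nat.find_spec hex⟩
  rcases hm : Nat.find hex with _ | m
  · simpa using h.zero_le a
  · exact (htot _ _).resolve_right (Nat.find_min hex (by omega : m < Nat.find hex))

theorem rank_mono (h : IsStrassenPreorder P) (htot : ∀ a b, P a b ∨ P b a) {a b : S}
    (hab : P a b) : rank P a ≤ rank P b := by
  by_contra! hlt
  obtain ⟨s, hs⟩ := exists_nat_gt (1 / (rank P a - rank P b))
  obtain ⟨r, h1, h2⟩ := h.exists_natCast_approx htot (s * b)
  have e1 := (h.natCast_le_rank_and b).1 _ _ h1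
  have e2 := (h.natCast_le_rank_and a).2 _ _ (h.trans _ _ _ (h.mul_left _ hab) h2)
  rw [div_lt_iff₀ (by linarith)] at hs
  push_cast at e2
  linarith

theorem eq_of_nat_mul_abs_sub_le {x y c : ℝ} (h : ∀ s : ℕ, 0 < s → s * |x - y| ≤ c) : x = y := by
  by_contra hne
  have hpos : 0 < |x - y| := abs_pos.2 (sub_ne_zero.2 hne)
  obtain ⟨s, hs⟩ := exists_nat_gt (c / |x - y|)
  rw [div_lt_iff₀ hpos] at hs
  have := h (s + 1) (by omega)
  push_cast at this
  nlinarith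

theorem rank_add (h : IsStrassenPreorder P) (htot : ∀ a b, P a b ∨ P b a) (a b : S) :
    rank P (a + b) = rank P a + rank P b := by
  -- After scaling by `s`, both sides lie in `[r + q, r + q + 2]`.
  refine eq_of_nat_mul_abs_sub_le (c := 2) fun s hs => ?_
  obtain ⟨r, h1, h2⟩ := h.exists_natCast_approx htot (s * a)
  obtain ⟨q, h3, h4⟩ := h.exists_natCast_approx htot (s * b)
  have e1 := (h.natCast_le_rank_and a).1 _ _ h1
  have e2 := (h.natCast_le_rank_and a).2 _ _ h2
  have e3 := (h.natCast_le_rank_and b).1 _ _ h3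
  have e4 := (h.natCast_le_rank_and b).2 _ _ h4
  have e5 := (h.natCast_le_rank_and (a + b)).1 (r + q) s (by
    push_cast
    rw [mul_add]
    exact h.add_le_add h1 h3)
  have e6 := (h.natCast_le_rank_and (a + b)).2 (r + 1 + (q + 1)) s (by
    rw [mul_add, Nat.cast_add]
    exact h.add_le_add h2 h4)
  push_cast at *
  rw [← abs_of_nonneg (Nat.cast_nonneg (α := ℝ) s), ← abs_mul, abs_le]
  constructor <;> nlinarith

theorem rank_mul (h : IsStrassenPreorder P) (htot : ∀ a b, P a b ∨ P b a) (a b : S) :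
    rank P (a * b) = rank P a * rank P b := by
  -- After scaling by `s²`, both sides lie in `[r q, (r + 1)(q + 1)]`, of length `r + q + 1 ≤ s
  -- (rank P a + rank P b + 1)`.
  refine eq_of_nat_mul_abs_sub_le (c := rank P a + rank P b + 1) fun s hs => ?_
  obtain ⟨r, h1, h2⟩ := h.exists_natCast_approx htot (s * a)
  obtain ⟨q, h3, h4⟩ := h.exists_natCast_approx htot (s * b)
  have e1 := (h.natCast_le_rank_and a).1 _ _ h1
  have e2 := (h.natCast_le_rank_and a).2 _ _ h2
  have e3 := (h.natCast_le_rank_and b).1 _ _ h3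
  have e4 := (h.natCast_le_rank_and b).2 _ _ h4
  have hsab : ((s * s : ℕ) : S) * (a * b) = (s * a) * (s * b) := by
    push_cast
    ring
  have e5 := (h.natCast_le_rank_and (a * b)).1 (r * q) (s * s) (by
    rw [hsab, Nat.cast_mul]
    exact h.mul_le_mul h1 h3)
  have e6 := (h.natCast_le_rank_and (a * b)).2 ((r + 1) * (q + 1)) (s * s) (by
    rw [hsab, Nat.cast_mul]
    exact h.mul_le_mul h2 h4)
  push_cast at *
  have hs' : (1 : ℝ) ≤ s := by exact_mod_cast hs
  have ha := h.rank_nonneg a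
  have hb := h.rank_nonneg b
  have m1 : (r : ℝ) * q ≤ (s * rank P a) * (s * rank P b) := by gcongr
  have m2 : (s * rank P a) * (s * rank P b) ≤ ((r : ℝ) + 1) * (q + 1) := by gcongr
  have hle : (s : ℝ) * (s * |rank P (a * b) - rank P a * rank P b|) ≤
      s * (rank P a + rank P b + 1) := by
    rw [← mul_assoc, ← abs_of_nonneg (mul_nonneg (Nat.cast_nonneg (α := ℝ) s) (Nat.cast_nonneg s)),
      ← abs_mul, abs_le]
    constructor <;> nlinarith
  exact le_of_mul_le_mul_left hle (by linarith)

/-! ### Minimal homomorphisms and degenerate extensions -/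

theorem exists_monotone_ringHom (h : IsStrassenPreorder P) :
    ∃ φ : S →+* ℝ≥0, ∀ a b, P a b → φ a ≤ φ b := by
  obtain ⟨Q, hQ, hPQ, htot⟩ := h.exists_total
  have h0 := hQ.rank_natCast 0
  have h1 := hQ.rank_natCast 1
  push_cast at h0 h1
  refine ⟨⟨⟨⟨fun a => ⟨rank Q a, hQ.rank_nonneg a⟩, ?_⟩, ?_⟩, ?_, ?_⟩, ?_⟩
  · exact NNReal.eq h1
  · exact fun a b => NNReal.eq (hQ.rank_mul htot a b)
  · exact NNReal.eq h0
  · exact fun a b => NNReal.eq (hQ.rank_add htot a b)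
  · exact fun a b hab => hQ.rank_mono htot (hPQ _ _ hab)

/-- The monotone homomorphisms form a closed subset of the product of the intervals `[0, n x]`,
where `x ≤ n x`; this is compact, and evaluation at `a` is continuous. -/
theorem exists_minimal_ringHom (h : IsStrassenPreorder P) (a : S) :
    ∃ φ : S →+* ℝ≥0, (∀ x y, P x y → φ x ≤ φ y) ∧
      ∀ ψ : S →+* ℝ≥0, (∀ x y, P x y → ψ x ≤ ψ y) → φ a ≤ ψ a := by
  choose n hn using h.exists_le_natCast
  let K : Set (S → ℝ≥0) := {f | f 0 = 0} ∩ {f | f 1 = 1} ∩ {f | ∀ x y, f (x + y) = f x + f y} ∩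
    {f | ∀ x y, f (x * y) = f x * f y} ∩ {f | ∀ x y, P x y → f x ≤ f y}
  have hmem : ∀ ψ : S →+* ℝ≥0, (∀ x y, P x y → ψ x ≤ ψ y) → (ψ : S → ℝ≥0) ∈ K := fun ψ hψ =>
    ⟨⟨⟨⟨map_zero ψ, map_one ψ⟩, map_add ψ⟩, map_mul ψ⟩, hψ⟩
  have hex : ∀ f ∈ K, ∃ φ : S →+* ℝ≥0, (φ : S → ℝ≥0) = f ∧ ∀ x y, P x y → φ x ≤ φ y := by
    rintro f ⟨⟨⟨⟨h0, h1⟩, hadd⟩, hmul⟩, hmono⟩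
    exact ⟨⟨⟨⟨f, h1⟩, hmul⟩, h0, hadd⟩, rfl, hmono⟩
  have hclosed : IsClosed K := by
    refine (((IsClosed.inter ?_ ?_).inter ?_).inter ?_).inter ?_
    · exact isClosed_eq (by fun_prop) (by fun_prop)
    · exact isClosed_eq (by fun_prop) (by fun_prop)
    · simp only [Set.ofPred_forall]
      exact isClosed_iInter fun x => isClosed_iInter fun y =>
        isClosed_eq (by fun_prop) (by fun_prop)
    · simp only [Set.ofPred_forall]
      exact isClosed_iInter fun x => isClosed_iInter fun y =>
        isClosed_eq (by fun_prop) (by fun_prop)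
    · simp only [Set.ofPred_forall]
      exact isClosed_iInter fun x => isClosed_iInter fun y => isClosed_iInter fun _ =>
        isClosed_le (by fun_prop) (by fun_prop)
  have hcompact : IsCompact K := by
    refine (isCompact_univ_pi fun x => isCompact_Icc (a := (0 : ℝ≥0)) (b := n x)).of_isClosed_subset
      hclosed fun f hf x _ => ⟨_root_.zero_le, ?_⟩
    obtain ⟨φ, rfl, hφ⟩ := hex f hf
    simpa using hφ _ _ (hn x)
  obtain ⟨ψ₀, hψ₀⟩ := h.exists_monotone_ringHom
  obtain ⟨f, hf, hmin⟩ := hcompact.exists_isMinOn ⟨_, hmem ψ₀ hψ₀⟩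
    (f := fun f => f a) (by fun_prop)
  obtain ⟨φ, rfl, hφ⟩ := hex f hf
  exact ⟨φ, hφ, fun ψ hψ => hmin (hmem ψ hψ)⟩

/-- If adding `a ≤ b` is degenerate then powers of `b` are dominated by powers of `a`. -/
theorem exists_pow_le_mul_pow (h : IsStrassenPreorder P) {a : S} {b : ℕ} (ha : P 1 a)
    (hdeg : ¬ IsStrassenPreorder (extendPreorder P a b)) :
    ∃ R : ℕ, ∀ N : ℕ, P ((b ^ N : ℕ) : S) (R * a ^ N) := by
  obtain ⟨n, u, hu⟩ : ∃ n : ℕ, extendPreorder P a b (n + 1 : ℕ) n := by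
    by_contra! hc
    exact hdeg (h.extend _ _ hc)
  have hu0 : u ≠ 0 := by
    rintro rfl
    exact h.not_succ_le n (by simpa using hu)
  have iter : ∀ k : ℕ, P ((k + n : ℕ) + k * (u * b)) (n + k * (u * a)) := by
    intro k
    induction k with
    | zero => simpa using h.refl (n : S)
    | succ k ih =>
      refine h.trans _ ((k : S) * (u * b) + (n + u * a) + k) _ ?_ ?_
      · convert h.add_right _ _ ((k : S) * (u * b) + k) hu using 1 <;> · push_cast; ring
      · convert h.add_right _ _ (u * a) ih using 1 <;> · push_cast; ring
  -- After `n * b + 1` iterations the surplus on the left absorbs `n * b`, giving `v b ≤ v a`. The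
  -- extra `1` keeps `u` as a summand of `v`, so that `1 ≤ v`.
  set v : S := n + (n * b + 1 : ℕ) * u with hv
  have hvab : P (v * b) (v * a) := by
    refine h.trans _ _ _ ?_ (h.trans _ _ _ (iter (n * b + 1)) ?_)
    · convert h.le_add_left _ ((n + 1 : ℕ) : S) using 1
      rw [hv]
      push_cast
      ring
    · convert h.add_right _ _ (((n * b + 1 : ℕ) : S) * (u * a)) (h.mul_left (n : S) ha) using 1
      · ring
      · rw [hv]
        ring
  have hpow : ∀ N : ℕ, P (v * (b : S) ^ N) (v * a ^ N) := by
    intro N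
    induction N with
    | zero => simpa using h.refl v
    | succ N ih =>
      refine h.trans _ (v * b * a ^ N) _ ?_ ?_
      · convert h.mul_right _ _ (b : S) ih using 1 <;> ring
      · convert h.mul_right _ _ (a ^ N) hvab using 1
        ring
  have h1v : P 1 v := by
    refine h.trans _ _ _ (h.one_le u hu0) ?_
    convert h.le_add_left u ((n : S) + (n * b : ℕ) * u) using 1
    rw [hv]
    push_cast
    ring
  obtain ⟨R, hR⟩ := h.exists_le_natCast v
  refine ⟨R, fun N => ?_⟩
  have := h.trans _ _ _ (h.mul_right _ _ ((b : S) ^ N) h1v)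
    (h.trans _ _ _ (hpow N) (h.mul_right _ _ _ hR))
  simpa using this

end IsStrassenPreorder

/-! ### Orthogonal projections -/

section Projections

open scoped ComplexOrder

variable {ι : Type*} [Fintype ι]

theorem IsStarProjection.conjTranspose_mul_self {p : Matrix ι ι ℂ} (hp : IsStarProjection p) :
    p.conjTranspose * p = p := by
  have h1 : p.conjTranspose = p := hp.isSelfAdjoint
  rw [h1, hp.isIdempotentElem]

theorem IsStarProjection.trace_nonneg {p : Matrix ι ι ℂ} (hp : IsStarProjection p) :
    0 ≤ p.trace := by
  rw [← hp.conjTranspose_mul_self]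
  exact (Matrix.posSemidef_conjTranspose_mul_self p).trace_nonneg

/-- Projections that sum to the identity are pairwise orthogonal. -/
theorem IsStarProjection.mul_eq_zero_of_sum_eq_one [DecidableEq ι] {W : Type*} [Fintype W]
       {E : W → Matrix ι ι ℂ} (hE : ∀ h, IsStarProjection (E h)) (hsum : ∑ h, E h = 1) {h k : W}
    (hne : h ≠ k) : E h * E k = 0 := by
  classical
  have hs : ∀ j, (E j).conjTranspose = E j := fun j => (hE j).isSelfAdjoint
  have hi : ∀ j, E j * E j = E j := fun j => (hE j).isIdempotentElem
  -- Expanding `E k * 1 * E k` leaves off-diagonal terms with sum zero. Each is positive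
  -- semidefinite by this identity, so each has trace zero and vanishes.
  have hsq : ∀ j, (E j * E k).conjTranspose * (E j * E k) = E k * E j * E k := by
    intro j
    rw [Matrix.conjTranspose_mul, hs, hs, mul_assoc, ← mul_assoc (E j), hi, mul_assoc]
  have htot : ∑ j, E k * E j * E k = E k := by
    rw [← Finset.sum_mul, ← Finset.mul_sum, hsum, mul_one, hi]
  rw [← Finset.add_sum_erase _ _ (Finset.mem_univ k), hi, hi, add_eq_left] at htot
  have htr : ∑ j ∈ Finset.univ.erase k, (E k * E j * E k).trace = 0 := by
    rw [← Matrix.trace_sum, htot, Matrix.trace_zero]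
  rw [Finset.sum_eq_zero_iff_of_nonneg] at htr
  · have := htr h (Finset.mem_erase.2 ⟨hne, Finset.mem_univ h⟩)
    rwa [← hsq, Matrix.trace_conjTranspose_mul_self_eq_zero_iff] at this
  · intro j _
    rw [← hsq]
    exact (Matrix.posSemidef_conjTranspose_mul_self _).trace_nonneg

theorem IsStarProjection.sum {α A : Type*} [Ring A] [StarRing A] (s : Finset α) {E : α → A}
    (hE : ∀ a ∈ s, IsStarProjection (E a))
    (hort : ∀ a ∈ s, ∀ b ∈ s, a ≠ b → E a * E b = 0) :
    IsStarProjection (∑ a ∈ s, E a) where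
  isIdempotentElem := by
    rw [IsIdempotentElem, Finset.sum_mul]
    refine Finset.sum_congr rfl fun a ha => ?_
    rw [Finset.mul_sum, Finset.sum_eq_single_of_mem a ha fun b hb hba => hort a ha b hb hba.symm]
    exact (hE a ha).isIdempotentElem
  isSelfAdjoint := isSelfAdjoint_sum s fun a ha => (hE a ha).isSelfAdjoint

end Projections

/-! ### Quantum homomorphisms -/

namespace QuantumHom

open scoped Kronecker

theorem of_matrix {V W ι : Type*} [Fintype W] [Fintype ι] [DecidableEq ι] [Nonempty ι]
    {G : SimpleGraph V} {H : SimpleGraph W} (E : V → W → Matrix ι ι ℂ)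
    (h1 : ∀ g h, IsStarProjection (E g h)) (h2 : ∀ g, ∑ h, E g h = 1)
    (h3 : ∀ g g' h h', G.Adj g g' → ¬ H.Adj h h' → E g h * E g' h' = 0) : QuantumHom G H := by
  let e := (Fintype.equivFin ι)
  refine ⟨Fintype.card ι, Fintype.card_pos, fun g h => Matrix.reindexAlgEquiv ℂ ℂ e (E g h),
    fun g h => ⟨(h1 g h).isIdempotentElem.map _, ?_⟩, fun g => ?_, fun g g' h h' hg hh => ?_⟩
  · have : (E g h).conjTranspose = E g h := (h1 g h).isSelfAdjoint
    change (Matrix.reindex e e (E g h)).conjTranspose = Matrix.reindex e e (E g h)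
    rw [Matrix.conjTranspose_reindex, this]
  · rw [← map_sum, h2, map_one]
  · rw [← map_mul, h3 g g' h h' hg hh, map_zero]

theorem trans {V W X : Type*} [Fintype W] [Fintype X] {G : SimpleGraph V} {H : SimpleGraph W}
    {K : SimpleGraph X} (hGH : QuantumHom G H) (hHK : QuantumHom H K) : QuantumHom G K := by
  classical
  obtain ⟨d, hd, E, hE1, hE2, hE3⟩ := hGH
  obtain ⟨e, he, F, hF1, hF2, hF3⟩ := hHK
  have : Nonempty (Fin d) := ⟨⟨0, hd⟩⟩
  have : Nonempty (Fin e) := ⟨⟨0, he⟩⟩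
  -- Composition sums over the intermediate vertex on a tensor product. The summands are orthogonal
  -- because `E g h * E g h' = 0` for `h ≠ h'`.
  refine of_matrix (fun g k => ∑ h, E g h ⊗ₖ F h k) (fun g k => ?_) (fun g => ?_) ?_
  · refine IsStarProjection.sum _ (fun h _ => ⟨?_, ?_⟩) fun h _ h' _ hne => ?_
    · rw [IsIdempotentElem, ← Matrix.mul_kronecker_mul, (hE1 g h).isIdempotentElem,
        (hF1 h k).isIdempotentElem]
    · have e1 : (E g h).conjTranspose = E g h := (hE1 g h).isSelfAdjoint
      have e2 : (F h k).conjTranspose = F h k := (hF1 h k).isSelfAdjoint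
      change (E g h ⊗ₖ F h k).conjTranspose = _
      rw [Matrix.conjTranspose_kronecker, e1, e2]
    · rw [← Matrix.mul_kronecker_mul,
        IsStarProjection.mul_eq_zero_of_sum_eq_one (hE1 g) (hE2 g) hne, Matrix.zero_kronecker]
  · rw [Finset.sum_comm]
    have hk : ∀ h, ∑ k, E g h ⊗ₖ F h k = E g h ⊗ₖ (1 : Matrix (Fin e) (Fin e) ℂ) := by
      intro h
      rw [← hF2 h]
      ext i j
      simp [Matrix.sum_apply, Finset.mul_sum]
    simp only [hk]
    rw [← Matrix.one_kronecker_one, ← hE2 g]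
    ext i j
    simp [Matrix.sum_apply, Finset.sum_mul]
  · intro g g' k k' hg hk
    rw [Finset.sum_mul]
    refine Finset.sum_eq_zero fun h _ => ?_
    rw [Finset.mul_sum]
    refine Finset.sum_eq_zero fun h' _ => ?_
    rw [← Matrix.mul_kronecker_mul]
    by_cases hh : H.Adj h h'
    · rw [hF3 h h' k k' hh hk, Matrix.kronecker_zero]
    · rw [hE3 g g' h h' hg hh, Matrix.zero_kronecker]

theorem of_hom {V W : Type*} [Fintype W] {G : SimpleGraph V} {H : SimpleGraph W} (f : G →g H) :
    QuantumHom G H := by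
  classical
  refine ⟨1, one_pos, fun g h => if f g = h then 1 else 0, fun g h => ?_, fun g => by simp, ?_⟩
  · dsimp only
    split_ifs
    exacts [.one _, .zero _]
  · intro g g' h h' hg hh
    by_cases h1 : f g = h
    · by_cases h2 : f g' = h'
      · subst h1 h2
        exact absurd (f.map_adj hg) hh
      · simp [h2]
    · simp [h1]

/-- A quantum homomorphism between complete graphs does not decrease the order. -/
theorem le_of_top {V W : Type*} [Fintype V] [Fintype W]
    (h : QuantumHom (⊤ : SimpleGraph V) (⊤ : SimpleGraph W)) :
    Fintype.card V ≤ Fintype.card W := by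
  classical
  obtain ⟨d, hd, E, hE1, hE2, hE3⟩ := h
  -- For fixed `k` the `E g k` are pairwise orthogonal, so their sum is a projection, of trace at
  -- most `d`. Counting the total trace both ways compares the orders.
  have hle : ∀ k, ∑ g, (E g k).trace.re ≤ d := by
    intro k
    have hp : IsStarProjection (∑ g, E g k) :=
      IsStarProjection.sum _ (fun g _ => hE1 g k) fun g _ g' _ hne =>
        hE3 g g' k k (by simpa using hne) (by simp)
    have := (Complex.le_def.1 hp.one_sub.trace_nonneg).1
    simp [Matrix.trace_sum] at this
    exact this
  have heq : ∀ g, ∑ k, (E g k).trace.re = d := by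
    intro g
    rw [← Complex.re_sum, ← Matrix.trace_sum, hE2]
    simp
  have : (Fintype.card V : ℝ) * d ≤ Fintype.card W * d := by
    calc (Fintype.card V : ℝ) * d = ∑ g, ∑ k, (E g k).trace.re := by simp [heq]
      _ = ∑ k, ∑ g, (E g k).trace.re := Finset.sum_comm
      _ ≤ ∑ _k : W, (d : ℝ) := Finset.sum_le_sum fun k _ => hle k
      _ = _ := by simp
  have hd' : (0 : ℝ) < d := by exact_mod_cast hd
  exact_mod_cast le_of_mul_le_mul_right this hd'

end QuantumHom

/-! ### Compatibility with the semiring operations -/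

namespace QuantumCohom

theorem add_right {V W X : Type*} [Fintype W] [Fintype X] {G : SimpleGraph V}
    {H : SimpleGraph W} (K : SimpleGraph X) (h : QuantumCohom G H) :
    QuantumCohom (G ⊕g K) (H ⊕g K) := by
  classical
  obtain ⟨d, hd, E, hE1, hE2, hE3⟩ := h
  refine ⟨d, hd, fun
    | .inl g, .inl h => E g h
    | .inr x, .inr y => if x = y then 1 else 0
    | _, _ => 0, ?_, ?_, ?_⟩
  · rintro (g | x) (h | y)
    · exact hE1 g h
    · exact .zero _
    · exact .zero _
    · dsimp only
      split_ifs
      exacts [.one _, .zero _]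
  · rintro (g | x)
    · simp [hE2]
    · simp
  · rintro (g | x) (g' | x') (h | y) (h' | y') hg hh <;>
      simp only [mul_zero, zero_mul]
    · exact hE3 g g' h h' (by simpa [SimpleGraph.sum] using hg) (by simpa [SimpleGraph.sum] using hh)
    · exact absurd hh (by simp [SimpleGraph.sum])
    · exact absurd hh (by simp [SimpleGraph.sum])
    · by_cases h1 : x = y
      · by_cases h2 : x' = y'
        · subst h1 h2
          exact absurd (by simpa [SimpleGraph.sum] using hg) hh
        · simp [h2]
      · simp [h1]

theorem mul_right {V W X : Type*} [Fintype W] [Fintype X] {G : SimpleGraph V}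
    {H : SimpleGraph W} (K : SimpleGraph X) (h : QuantumCohom G H) :
    QuantumCohom (strongProd G K) (strongProd H K) := by
  classical
  obtain ⟨d, hd, E, hE1, hE2, hE3⟩ := h
  refine ⟨d, hd, fun g h => if g.2 = h.2 then E g.1 h.1 else 0, ?_, ?_, ?_⟩
  · rintro ⟨g, x⟩ ⟨h, y⟩
    dsimp only
    split_ifs
    exacts [hE1 g h, .zero _]
  · rintro ⟨g, x⟩
    rw [Fintype.sum_prod_type]
    simp [hE2]
  · rintro ⟨g, x⟩ ⟨g', x'⟩ ⟨h, y⟩ ⟨h', y'⟩ hg hh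
    by_cases h1 : x = y
    · by_cases h2 : x' = y'
      · subst h1 h2
        -- By `hh`, the shared coordinates `x` and `x'` are equal or adjacent in `K`, so the
        -- non-adjacency in `hg` must come from `g` and `g'`.
        have hg' : Gᶜ.Adj g g' := by
          simp only [SimpleGraph.compl_adj, strongProd, ne_eq, Prod.mk.injEq] at hg hh ⊢
          have := @SimpleGraph.irrefl _ K
          by_cases hx : x = x'
          · subst hx; tauto
          · tauto
        have hh' : ¬ Hᶜ.Adj h h' := by
          simp only [SimpleGraph.compl_adj, strongProd, ne_eq, Prod.mk.injEq] at hg hh ⊢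
          tauto
        simp [hE3 g g' h h' hg' hh']
      · simp [h2]
    · simp [h1]

end QuantumCohom

namespace GraphClass

theorem isStrassenPreorder_qle : IsStrassenPreorder QLE.{u} where
  refl a := by
    induction a using ind with | _ V G
    exact QuantumHom.of_hom .id
  trans a b c := by
    induction a using ind with | _ V G
    induction b using ind with | _ W H
    induction c using ind with | _ X K
    exact QuantumHom.trans
  add_right a b c := by
    induction a using ind with | _ V G
    induction b using ind with | _ W H
    induction c using ind with | _ X K
    exact QuantumCohom.add_right K
  mul_right a b c := by
    induction a using ind with | _ V G
    induction b using ind with | _ W H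
    induction c using ind with | _ X K
    exact QuantumCohom.mul_right K
  zero_le a := by
    induction a using ind with | _ V G
    exact QuantumHom.of_hom ⟨fun x => x.down.elim0, fun {x} => x.down.elim0⟩
  one_le a := by
    induction a using ind with | _ V G
    intro hne
    have : Nonempty V := by
      by_contra hV
      rw [not_nonempty_iff] at hV
      exact hne (mk_eq_of_iso ⟨Equiv.equivOfIsEmpty _ _, fun {x} => isEmptyElim x⟩)
    obtain ⟨v⟩ := this
    exact QuantumHom.of_hom ⟨fun _ => v, fun {x y} h => absurd (Subsingleton.elim x y) h.ne⟩
  exists_le_natCast a := by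
    induction a using ind with | _ V G
    refine ⟨Fintype.card V, QuantumHom.of_hom ⟨fun v => ⟨Fintype.equivFin V v⟩, ?_⟩⟩
    intro x y h
    simpa using h.ne
  not_succ_le n h := by
    have h' : QuantumHom (⊥ : SimpleGraph (ULift.{u} (Fin (n + 1))))ᶜ
      (⊥ : SimpleGraph (ULift.{u} (Fin n)))ᶜ := h
    rw [compl_bot, compl_bot] at h'
    have := h'.le_of_top
    simp at this

/-- A graph is empty, complete, or contains two nonadjacent vertices. -/
theorem eq_zero_or_le_one_or_two_le (a : GraphClass.{u}) :
    a = 0 ∨ QLE a 1 ∨ QLE ((2 : ℕ) : GraphClass.{u}) a := by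
  induction a using ind with | _ V G
  refine Or.inr ?_
  by_cases h : ∃ x y, Gᶜ.Adj x y
  · obtain ⟨x, y, hxy⟩ := h
    refine Or.inr (QuantumHom.of_hom ⟨fun i => if i.down = 0 then x else y, ?_⟩)
    rintro ⟨i⟩ ⟨j⟩ hij
    have hne : i ≠ j := by simpa using hij
    fin_cases i <;> fin_cases j <;> simp_all [hxy.symm]
  · push Not at h
    exact Or.inl (QuantumHom.of_hom ⟨fun _ => ⟨0⟩, fun {x y} hxy => absurd hxy (h x y)⟩)

end GraphClass

/-! ### Quantum independence numbers and the limit -/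

namespace GraphClass

theorem isGreatest_quantumIndepNum (a : GraphClass.{u}) :
    IsGreatest {n : ℕ | QLE (edgeless n) a} (quantumIndepNum a) := by
  obtain ⟨m, hm⟩ := isStrassenPreorder_qle.exists_le_natCast a
  have hb : BddAbove {n : ℕ | QLE (edgeless n) a} := ⟨m, fun n hn =>
    isStrassenPreorder_qle.natCast_le.1 (isStrassenPreorder_qle.trans _ _ _ hn hm)⟩
  exact ⟨Nat.sSup_mem ⟨0, isStrassenPreorder_qle.zero_le a⟩ hb, fun n hn => le_csSup hb hn⟩

theorem le_quantumIndepNum {a : GraphClass.{u}} {n : ℕ} (h : QLE (n : GraphClass.{u}) a) :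
    n ≤ quantumIndepNum a :=
  (isGreatest_quantumIndepNum a).2 h

theorem quantumIndepNum_qle (a : GraphClass.{u}) : QLE (quantumIndepNum a : GraphClass.{u}) a :=
  (isGreatest_quantumIndepNum a).1

theorem quantumIndepNum_mul_le (a b : GraphClass.{u}) :
    quantumIndepNum a * quantumIndepNum b ≤ quantumIndepNum (a * b) := by
  refine le_quantumIndepNum ?_
  rw [Nat.cast_mul]
  exact isStrassenPreorder_qle.mul_le_mul (quantumIndepNum_qle a) (quantumIndepNum_qle b)

theorem quantumIndepNum_zero : quantumIndepNum (0 : GraphClass.{u}) = 0 := by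
  have h : QLE (quantumIndepNum (0 : GraphClass.{u}) : GraphClass.{u}) ((0 : ℕ) : GraphClass.{u}) :=
    quantumIndepNum_qle 0
  simpa using isStrassenPreorder_qle.natCast_le.1 h

theorem one_le_quantumIndepNum_pow {a : GraphClass.{u}} (ha : a ≠ 0) (N : ℕ) :
    1 ≤ quantumIndepNum (a ^ N) := by
  refine le_quantumIndepNum ?_
  simpa using isStrassenPreorder_qle.pow_le_pow (isStrassenPreorder_qle.one_le a ha) N

/-- The input to Fekete's lemma. For `a ≠ 0` the independence numbers are at least 1, so the
logarithms are additive on products. -/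
theorem subadditive_neg_log_quantumIndepNum {a : GraphClass.{u}} (ha : a ≠ 0) :
    Subadditive fun N => -Real.log (quantumIndepNum (a ^ N)) := by
  intro m n
  have hm := one_le_quantumIndepNum_pow ha m
  have hn := one_le_quantumIndepNum_pow ha n
  have hle : (quantumIndepNum (a ^ m) : ℝ) * quantumIndepNum (a ^ n) ≤
      quantumIndepNum (a ^ (m + n)) := by
    rw [pow_add]
    exact_mod_cast quantumIndepNum_mul_le _ _
  have := Real.log_le_log (by positivity) hle
  rw [Real.log_mul (by positivity) (by positivity)] at this
  linarith

theorem bddBelow_neg_log_quantumIndepNum {a : GraphClass.{u}} (ha : a ≠ 0) :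
    BddBelow (Set.range fun N : ℕ => -Real.log (quantumIndepNum (a ^ N)) / N) := by
  obtain ⟨m, hm⟩ := isStrassenPreorder_qle.exists_le_natCast a
  refine ⟨-Real.log m, ?_⟩
  rintro _ ⟨N, rfl⟩
  have hN := one_le_quantumIndepNum_pow ha N
  have hle : quantumIndepNum (a ^ N) ≤ m ^ N := by
    rw [← isStrassenPreorder_qle.{u}.natCast_le, Nat.cast_pow]
    exact isStrassenPreorder_qle.trans _ _ _ (quantumIndepNum_qle _)
      (isStrassenPreorder_qle.pow_le_pow hm N)
  have hlog := Real.log_le_log (by positivity)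
    (show (quantumIndepNum (a ^ N) : ℝ) ≤ (m : ℝ) ^ N by exact_mod_cast hle)
  rw [Real.log_pow] at hlog
  dsimp only
  rcases Nat.eq_zero_or_pos N with rfl | hpos
  · simpa using Real.log_natCast_nonneg m
  · rw [le_div_iff₀ (by positivity)]
    linarith

theorem quantumIndepRoot_eq_exp {a : GraphClass.{u}} (ha : a ≠ 0) (N : ℕ) :
    quantumIndepRoot a N = Real.exp (-(-Real.log (quantumIndepNum (a ^ N)) / N)) := by
  have hN := one_le_quantumIndepNum_pow ha N
  rw [quantumIndepRoot, Real.rpow_def_of_pos (by positivity)]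
  congr 1
  ring

theorem exists_tendsto_isLUB_quantumIndepRoot (a : GraphClass.{u}) :
    ∃ θ : ℝ, Tendsto (quantumIndepRoot a) atTop (𝓝 θ) ∧
      IsLUB (quantumIndepRoot a '' {N : ℕ | 1 ≤ N}) θ := by
  by_cases ha : a = 0
  · subst ha
    have h0 : ∀ N : ℕ, 1 ≤ N → quantumIndepRoot (0 : GraphClass.{u}) N = 0 := by
      intro N hN
      rw [quantumIndepRoot, zero_pow (by omega), quantumIndepNum_zero, Nat.cast_zero,
        Real.zero_rpow (by positivity)]
    -- The sequence is zero only from `N = 1` on: at `N = 0` the exponent `1 / 0` is `0` and the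
    -- value is `1`.
    refine ⟨0, tendsto_const_nhds.congr' ?_, ?_, fun b hb => ?_⟩
    · filter_upwards [eventually_ge_atTop 1] with N hN using (h0 N hN).symm
    · rintro _ ⟨N, hN, rfl⟩
      exact (h0 N hN).le
    · simpa [h0 1 le_rfl] using hb ⟨1, le_refl 1, rfl⟩
  · have hsub := subadditive_neg_log_quantumIndepNum ha
    have hbdd := bddBelow_neg_log_quantumIndepNum ha
    have hlim : Tendsto (quantumIndepRoot a) atTop (𝓝 (Real.exp (-hsub.lim))) := by
      simp only [funext (quantumIndepRoot_eq_exp ha)]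
      exact (Real.continuous_exp.tendsto _).comp (hsub.tendsto_lim hbdd).neg
    refine ⟨_, hlim, ?_, fun b hb => ?_⟩
    · rintro _ ⟨N, hN, rfl⟩
      rw [quantumIndepRoot_eq_exp ha]
      exact Real.exp_le_exp.2 (neg_le_neg (hsub.lim_le_div hbdd (Nat.one_le_iff_ne_zero.1 hN)))
    · refine le_of_tendsto hlim ?_
      filter_upwards [eventually_ge_atTop 1] with N hN using hb ⟨N, hN, rfl⟩

theorem quantumIndepRoot_pow (a : GraphClass.{u}) {N : ℕ} (hN : 1 ≤ N) :
    quantumIndepRoot a N ^ N = quantumIndepNum (a ^ N) := by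
  rw [quantumIndepRoot, one_div, Real.rpow_inv_natCast_pow (by positivity) (by omega)]

theorem quantumIndepRoot_nonneg (a : GraphClass.{u}) (N : ℕ) : 0 ≤ quantumIndepRoot a N :=
  Real.rpow_nonneg (Nat.cast_nonneg _) _

theorem quantumIndepRoot_le {φ : GraphClass.{u} →+* ℝ≥0} (hφ : φ ∈ quantumAsymptoticSpectrum)
    (a : GraphClass.{u}) {N : ℕ} (hN : 1 ≤ N) : quantumIndepRoot a N ≤ φ a := by
  refine le_of_pow_le_pow_left₀ (by omega : N ≠ 0) (φ a).coe_nonneg ?_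
  rw [quantumIndepRoot_pow a hN]
  have := hφ _ _ (quantumIndepNum_qle (a ^ N))
  rw [map_natCast, map_pow] at this
  exact_mod_cast this

/-! ### The duality bound -/

/-- If `2 ≤ a` and `r` exceeds the bound for the `M`-th power, the relation `a ^ M ≤ r` can be
added without degeneracy. -/
theorem isStrassenPreorder_extend_pow {a : GraphClass.{u}} {θ : ℝ}
    (h2 : QLE ((2 : ℕ) : GraphClass.{u}) a) (hθ : 0 < θ)
    (hbound : ∀ N : ℕ, 1 ≤ N → (quantumIndepNum (a ^ N) : ℝ) ≤ θ ^ N) {M r : ℕ}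
    (hr : θ ^ M < r) : IsStrassenPreorder (extendPreorder QLE (a ^ M) (r : GraphClass.{u})) := by
  have h := isStrassenPreorder_qle.{u}
  by_contra hdeg
  have h1 : QLE 1 a := h.trans _ _ _ (by simpa using h.natCast_le.2 one_le_two) h2
  obtain ⟨R, hR⟩ := h.exists_pow_le_mul_pow (by simpa using h.pow_le_pow h1 M) hdeg
  -- This absorbs the constant `R` into a fixed power of `a`; it is where `2 ≤ a` is essential.
  have hRa : QLE (R : GraphClass.{u}) (a ^ R) := by
    refine h.trans _ ((2 ^ R : ℕ) : GraphClass.{u}) _ (h.natCast_le.2 R.lt_two_pow_self.le) ?_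
    simpa using h.pow_le_pow h2 R
  have key : ∀ N : ℕ, 1 ≤ R + M * N → (r : ℝ) ^ N ≤ θ ^ R * (θ ^ M) ^ N := by
    intro N hN
    have hle : r ^ N ≤ quantumIndepNum (a ^ (R + M * N)) := by
      refine le_quantumIndepNum ?_
      rw [pow_add, pow_mul]
      exact h.trans _ _ _ (hR N) (h.mul_right _ _ _ hRa)
    rw [← pow_mul, ← pow_add]
    exact le_trans (by exact_mod_cast hle) (hbound _ hN)
  -- The case `N = 0` of `hR` reads `1 ≤ R`, so every exponent `R + M * N` is positive and `hbound`
  -- applies.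
  have hR1 : 1 ≤ R := by
    have := hR 0
    simp only [pow_zero, mul_one] at this
    exact h.natCast_le.1 this
  obtain ⟨N, hN⟩ := pow_unbounded_of_one_lt (θ ^ R) ((one_lt_div (pow_pos hθ M)).2 hr)
  rw [div_pow, lt_div_iff₀ (by positivity)] at hN
  exact absurd (key N (by omega)) (not_le.2 hN)

theorem exists_mem_quantumAsymptoticSpectrum_le {a : GraphClass.{u}} {θ : ℝ}
    (hbound : ∀ N : ℕ, 1 ≤ N → (quantumIndepNum (a ^ N) : ℝ) ≤ θ ^ N) :
    ∃ φ ∈ quantumAsymptoticSpectrum.{u}, (φ a : ℝ) ≤ θ := by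
  have h := isStrassenPreorder_qle.{u}
  obtain ⟨φ, hφ, hmin⟩ := h.exists_minimal_ringHom a
  refine ⟨φ, hφ, ?_⟩
  have hb1 : (quantumIndepNum a : ℝ) ≤ θ := by simpa using hbound 1 le_rfl
  have hθ0 : 0 ≤ θ := le_trans (Nat.cast_nonneg _) hb1
  by_cases ha : a = 0
  · subst ha
    simpa using hθ0
  have hα : 1 ≤ quantumIndepNum a := by simpa using one_le_quantumIndepNum_pow ha 1
  have hθ1 : 1 ≤ θ := le_trans (by exact_mod_cast hα) hb1
  rcases (eq_zero_or_le_one_or_two_le a).resolve_left ha with h1 | h2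
  · have := hφ _ _ h1
    rw [map_one] at this
    exact le_trans (by exact_mod_cast this) hθ1
  -- The factor 2 covers the rounding to `⌊θ ^ M⌋₊ + 1`, as `1 ≤ θ ^ M`. The witness `ψ` depends on
  -- `M`, but the minimal `φ` lies below each of them.
  · have hpow : ∀ M : ℕ, (φ a : ℝ) ^ M ≤ 2 * θ ^ M := by
      intro M
      have hM := isStrassenPreorder_extend_pow h2 (by linarith) hbound
        (M := M) (r := ⌊θ ^ M⌋₊ + 1) (by exact_mod_cast Nat.lt_floor_add_one (θ ^ M))
      obtain ⟨ψ, hψ⟩ := hM.exists_monotone_ringHom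
      have hle := hψ _ _ (h.extendPreorder_self _ _)
      rw [map_pow, map_natCast] at hle
      have hle' : (ψ a : ℝ) ^ M ≤ ⌊θ ^ M⌋₊ + 1 := by exact_mod_cast hle
      have hφψ : (φ a : ℝ) ≤ ψ a :=
        hmin ψ fun x y hxy => hψ _ _ (IsStrassenPreorder.le_extendPreorder hxy)
      have hfloor := Nat.floor_le (pow_nonneg hθ0 M)
      have hone := one_le_pow₀ hθ1 (n := M)
      have := pow_le_pow_left₀ (φ a).coe_nonneg hφψ M
      linarith
    by_contra! hlt
    have hθ : 0 < θ := by linarith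
    obtain ⟨M, hM⟩ := pow_unbounded_of_one_lt 2 ((one_lt_div hθ).2 hlt)
    rw [div_pow, lt_div_iff₀ (by positivity)] at hM
    exact absurd (hpow M) (not_le.2 hM)

end GraphClass

theorem mainTheorem2 {V : Type u} [Fintype V] (G : SimpleGraph V) :
    IsGreatest {n : ℕ | GraphClass.QLE (GraphClass.edgeless n) (GraphClass.mk G)}
      (GraphClass.quantumIndepNum (GraphClass.mk G)) ∧
    Tendsto (GraphClass.quantumIndepRoot (GraphClass.mk G)) atTop
      (𝓝 (GraphClass.quantumShannonCapacity (GraphClass.mk G))) ∧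
    IsLUB (GraphClass.quantumIndepRoot (GraphClass.mk G) '' {N : ℕ | 1 ≤ N})
      (GraphClass.quantumShannonCapacity (GraphClass.mk G)) ∧
    IsLeast ((fun φ : GraphClass.{u} →+* ℝ≥0 => (φ (GraphClass.mk G) : ℝ)) ''
        GraphClass.quantumAsymptoticSpectrum)
      (GraphClass.quantumShannonCapacity (GraphClass.mk G)) := by
  obtain ⟨θ, hlim, hlub⟩ := GraphClass.exists_tendsto_isLUB_quantumIndepRoot (GraphClass.mk G)
  have hθ : GraphClass.quantumShannonCapacity (GraphClass.mk G) = θ := hlim.limUnder_eq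
  rw [hθ]
  have hle : ∀ φ ∈ GraphClass.quantumAsymptoticSpectrum.{u}, θ ≤ φ (GraphClass.mk G) := by
    refine fun φ hφ => hlub.2 ?_
    rintro _ ⟨N, hN, rfl⟩
    exact GraphClass.quantumIndepRoot_le hφ _ hN
  refine ⟨GraphClass.isGreatest_quantumIndepNum _, hlim, hlub, ?_, ?_⟩
  · obtain ⟨φ, hφ, hφθ⟩ := GraphClass.exists_mem_quantumAsymptoticSpectrum_le
      (a := GraphClass.mk G) (θ := θ) fun N hN => by
        rw [← GraphClass.quantumIndepRoot_pow _ hN]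
        exact pow_le_pow_left₀ (GraphClass.quantumIndepRoot_nonneg _ _) (hlub.1 ⟨N, hN, rfl⟩) N
    exact ⟨φ, hφ, le_antisymm hφθ (hle φ hφ)⟩
  · rintro _ ⟨φ, hφ, rfl⟩
    exact hle φ hφ
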